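/- Let $\mu>1$. For integers $n\ge 1$, $m\ge 0$ define the mask $a^{(n,m)}_\alpha$ ($\alpha\in\mathbb Z$) by $a^{(n,0)}_0=a^{(n,0)}_1=\tfrac12$, $a^{(n,0)}_\alpha=0$ otherwise, and, for $m\ge1$, $$a^{(n,m)}_\alpha=\frac1{2^{\,n+1+m^{-\mu}}}\left[\binom{n+1}{\alpha}+4\bigl(2^{m^{-\mu}}-1\bigr)\binom{n-1}{\alpha-1}\right],\qquad 0\le\alpha\le n+1,$$ and $a^{(n,m)}_\alpha=0$ otherwise (with $\binom{n-1}{\alpha-1}=0$ when $\alpha-1<0$ or $\alpha-1>n-1$). Let $A^{(n,m)}(z)=\sum_\alpha a^{(n,m)}_\alpha z^\alpha$, and let $\phi^{(n,m)}:\mathbb R\to\mathbb R$ be the refinable function with Fourier transform $$\widehat\phi^{(n,m)}(\omega)=\prod_{k=m}^\infty A^{(n,k)}\bigl(e^{-i\omega/2^{k+1}}\bigr),\qquad\text{i.e.}\qquad \phi^{(n,m)}(x)=\frac1{2\pi}\int_{\mathbb R}\widehat\phi^{(n,m)}(\omega)\,e^{i\omega x}\,d\omega .$$ For all $n\ge1$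 and $m\ge 0$ these functions are well defined (the product converges unconditionally for every $\omega\in\mathbb R$, and $\widehat\phi^{(n,m)}$ is integrable on $\mathbb R$), and they solve the nonstationary refinable equations $$\phi^{(n,m)}(x)=\sum_{\alpha}a^{(n,m)}_\alpha\,\phi^{(n,m+1)}\bigl(x-2^{-(m+1)}\alpha\bigr),\qquad x\in\mathbb R.$$ For $h>0$ let $\nabla_h f=\frac1h\bigl(f-f(\cdot-h)\bigr)$, $\nabla_h^0f=f$, and $\nabla_h^rf=\nabla_h(\nabla_h^{r-1}f)$ for $r\ge1$. **Theorem (differentiation rule).** Let $n\ge2$ and $0\le r\le n-1$ be integers. Then, for every $m\ge 0$, $\phi^{(n,m)}$ is $r$ times continuously differentiable on $\mathbb R$, and $$D^r\phi^{(n,0)}=\nabla^r_{1/2}\,\phi^{(n-r,0)},\qquad D^r\phi^{(n,m)}=\nabla^r_{2^{-m}}\,\phi^{(n-r,m)}\quad(m>0),$$ as identities of functions on $\mathbb R$. -/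

import Mathlib

/-- The mask coefficients `a^{(n,m)}_α` with tension parameter `μ`.  At level `m = 0` the mask is
`(1/2, 1/2)`.  At level `m ≥ 1` it is
`2^{-(n+1+m^{-μ})} [C(n+1,α) + 4 (2^{m^{-μ}} - 1) C(n-1,α-1)]` with `C(n-1,-1) = 0`;
this vanishes for `α > n + 1`.  Used for `n ≥ 1` only. -/
noncomputable def mask (μ : ℝ) (n m α : ℕ) : ℝ :=
  if m = 0 then (if α = 0 ∨ α = 1 then 1 / 2 else 0)
  else
    (1 / (2 : ℝ) ^ ((n : ℝ) + 1 + (m : ℝ) ^ (-μ))) *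
      (((n + 1).choose α : ℝ) +
        4 * ((2 : ℝ) ^ ((m : ℝ) ^ (-μ)) - 1) *
          (if α = 0 then 0 else ((n - 1).choose (α - 1) : ℝ)))

/-- The mask symbol `A^{(n,m)}(z) = ∑_α a^{(n,m)}_α z^α`. -/
noncomputable def maskSymbol (μ : ℝ) (n m : ℕ) (z : ℂ) : ℂ :=
  ∑ α ∈ Finset.range (n + 2), (mask μ n m α : ℂ) * z ^ α

/-- The factor `A^{(n,k)}(e^{-iω/2^{k+1}})`. -/
noncomputable def phiFactor (μ : ℝ) (n k : ℕ) (ω : ℝ) : ℂ :=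
  maskSymbol μ n k (Complex.exp (-Complex.I * (ω : ℂ) / 2 ^ (k + 1)))

/-- The Fourier transform of `φ^{(n,m)}` (convention `∫ f(x) e^{-iωx} dx`):
the infinite product `∏_{k ≥ m} A^{(n,k)}(e^{-iω/2^{k+1}})`. -/
noncomputable def phiHat (μ : ℝ) (n m : ℕ) (ω : ℝ) : ℂ :=
  ∏' j : ℕ, phiFactor μ n (m + j) ω

/-- The inverse Fourier integral `(1/2π) ∫ φ̂^{(n,m)}(ω) e^{iωx} dω`. -/
noncomputable def phiInv (μ : ℝ) (n m : ℕ) (x : ℝ) : ℂ :=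
  (1 / (2 * Real.pi) : ℂ) *
    ∫ ω : ℝ, phiHat μ n m ω * Complex.exp (Complex.I * (ω : ℂ) * (x : ℂ))

/-- The refinable function `φ^{(n,m)}`, a real function of a real variable.  Nothing is lost by
taking the real part: see `ofReal_phi`. -/
noncomputable def phi (μ : ℝ) (n m : ℕ) (x : ℝ) : ℝ :=
  (phiInv μ n m x).re

theorem phiFactor_neg (μ : ℝ) (n k : ℕ) (ω : ℝ) :
    phiFactor μ n k (-ω) = (starRingEnd ℂ) (phiFactor μ n k ω) := by
  unfold phiFactor maskSymbol
  rw [map_sum]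
  refine Finset.sum_congr rfl fun α _ => ?_
  rw [map_mul, map_pow, ← Complex.exp_conj, Complex.conj_ofReal]
  simp [Complex.conj_ofNat]

theorem phiHat_neg (μ : ℝ) (n m : ℕ) (ω : ℝ) :
    phiHat μ n m (-ω) = (starRingEnd ℂ) (phiHat μ n m ω) := by
  unfold phiHat
  have h := Complex.continuous_conj
  have key := Function.LeftInverse.map_tprod (fun j : ℕ => phiFactor μ n (m + j) ω)
    (L := SummationFilter.unconditional ℕ) (g := starRingEnd ℂ) (g' := starRingEnd ℂ) h h (fun z => Complex.conj_conj z)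
  rw [key]
  exact tprod_congr fun j => phiFactor_neg μ n (m + j) ω

/-- The inverse Fourier integral defining `φ^{(n,m)}` is real. -/
theorem ofReal_phi (μ : ℝ) (n m : ℕ) (x : ℝ) : (phi μ n m x : ℂ) = phiInv μ n m x := by
  unfold phi
  rw [← Complex.conj_eq_iff_re]
  unfold phiInv
  rw [map_mul, ← integral_conj, ← MeasureTheory.integral_neg_eq_self]
  congr 1
  · simp [Complex.conj_ofNat]
  · congr 1
    funext ω
    rw [map_mul, phiHat_neg, Complex.conj_conj, ← Complex.exp_conj]
    simp

/-- The normalized backward difference `∇_h f = (f - f(· - h)) / h`. -/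
noncomputable def nabla (h : ℝ) (f : ℝ → ℝ) : ℝ → ℝ :=
  fun x => (1 / h) * (f x - f (x - h))

/-- The iterates `∇_h^0 f = f`, `∇_h^r f = ∇_h (∇_h^{r-1} f)`. -/
noncomputable def nablaIter (h : ℝ) : ℕ → (ℝ → ℝ) → (ℝ → ℝ)
  | 0, f => f
  | r + 1, f => nabla h (nablaIter h r f)

/-! For `m ≥ 1` raising the order multiplies the symbol by `(1 + z) / 2`. Since `1 - w² = (1 - w)(1
+ w)`, these extra factors telescope over all levels, so that `iω φ̂^{(n+1,m)}` equals `φ̂^{(n,m)}`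
times the Fourier multiplier of `∇` (`phiHat_succ_mul`). Differentiating the inverse Fourier
integral gives `D φ^{(n+1,m)} = ∇ φ^{(n,m)}`, and `D` commutes with `∇`, so the rule follows by
induction on `r`.

The analytic difficulty is integrability down to order `1`. There the symbol has modulus `1 - s/2 +
(s/2) cos`, with `s` the tension, and it dominates all higher orders. Each further factor doubles
the period of the partial product and multiplies its integral over a period by `2 - s ≤ 1 + k^{-μ}`
(`integral_modProd`). As `μ > 1`, these integrals stay bounded, and so do the integrals of `‖φ̂‖`
over growing intervals. -/

/-! ### Factorization of the symbols -/

/-- The tension factor `2^{-k^{-μ}}`. -/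
noncomputable def tension (μ : ℝ) (k : ℕ) : ℝ := (2 : ℝ) ^ (-((k : ℝ) ^ (-μ)))

theorem tension_pos (μ : ℝ) (k : ℕ) : 0 < tension μ k := by
  unfold tension; positivity

theorem tension_le_one (μ : ℝ) (k : ℕ) : tension μ k ≤ 1 := by
  unfold tension
  apply Real.rpow_le_one_of_one_le_of_nonpos (by norm_num)
  have : 0 ≤ (k : ℝ) ^ (-μ) := by positivity
  linarith

theorem one_sub_tension_le (μ : ℝ) (k : ℕ) : 1 - tension μ k ≤ (k : ℝ) ^ (-μ) := by
  unfold tension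
  have hk : 0 ≤ (k : ℝ) ^ (-μ) := by positivity
  rw [Real.rpow_def_of_pos (by norm_num)]
  have h1 := Real.add_one_le_exp (Real.log 2 * -((k : ℝ) ^ (-μ)))
  have h2 : Real.log 2 ≤ 1 := by linarith [Real.log_two_lt_d9]
  nlinarith

theorem maskSymbol_zero (μ : ℝ) (n : ℕ) (z : ℂ) : maskSymbol μ n 0 z = (1 + z) / 2 := by
  unfold maskSymbol
  rw [Finset.sum_range_succ', Finset.sum_range_succ', Finset.sum_eq_zero]
  · simp [mask]; ring
  · intro α _
    simp [mask]

/-- For `m ≥ 1` the symbol is that of a B-spline times a quadratic factor. -/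
theorem maskSymbol_eq (μ : ℝ) (l : ℕ) {m : ℕ} (hm : m ≠ 0) (z : ℂ) :
    maskSymbol μ (l + 1) m z =
      ((1 + z) / 2) ^ l * (tension μ m * ((1 + z) / 2) ^ 2 + (1 - tension μ m) * z) := by
  set c : ℝ := (m : ℝ) ^ (-μ) with hc
  have hs : tension μ m * (2 : ℝ) ^ c = 1 := by
    unfold tension
    rw [← Real.rpow_add (by norm_num)]
    simp [hc]
  have hpow : (1 : ℝ) / (2 : ℝ) ^ (((l + 1 : ℕ) : ℝ) + 1 + c) = tension μ m / 2 ^ (l + 2) := by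
    have : ((l + 1 : ℕ) : ℝ) + 1 + c = ((l + 2 : ℕ) : ℝ) + c := by push_cast; ring
    rw [this, Real.rpow_add (by norm_num), Real.rpow_natCast]
    have : (2 : ℝ) ^ c ≠ 0 := by positivity
    field_simp
    linarith
  have h1 : ∑ α ∈ Finset.range (l + 3), (((l + 2).choose α : ℕ) : ℂ) * z ^ α = (1 + z) ^ (l + 2) := by
    rw [add_comm 1 z, add_pow]
    exact Finset.sum_congr rfl fun α _ => by ring
  have h2 : ∑ α ∈ Finset.range (l + 3),
      (if α = 0 then 0 else ((l.choose (α - 1) : ℕ) : ℂ)) * z ^ α = z * (1 + z) ^ l := by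
    rw [Finset.sum_range_succ', Finset.sum_range_succ, add_comm 1 z, add_pow, Finset.mul_sum]
    simp only [Nat.choose_succ_self, add_tsub_cancel_right]
    simp only [Nat.succ_ne_zero, if_false, if_true, Nat.cast_zero, zero_mul, add_zero]
    exact Finset.sum_congr rfl fun α _ => by ring
  have h3 : maskSymbol μ (l + 1) m z = ((tension μ m / 2 ^ (l + 2) : ℝ) : ℂ) *
      ((1 + z) ^ (l + 2) + 4 * (((2 : ℝ) ^ c : ℝ) - 1) * (z * (1 + z) ^ l)) := by
    rw [← h1, ← h2, Finset.mul_sum, ← Finset.sum_add_distrib, Finset.mul_sum]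
    unfold maskSymbol
    refine Finset.sum_congr rfl fun α _ => ?_
    simp only [mask, if_neg hm]
    rw [hpow]
    rcases eq_or_ne α 0 with h | h
    · simp [h, hc]
    · simp only [if_neg h, Nat.add_sub_cancel]
      push_cast
      ring
  have hsC : (tension μ m : ℂ) * (((2 : ℝ) ^ c : ℝ) : ℂ) = 1 := by exact_mod_cast hs
  rw [h3]
  push_cast at hsC ⊢
  rw [div_pow, div_pow, pow_add (1 + z) l 2, pow_add (2 : ℂ) l 2]
  linear_combination ((1 + z) ^ l / 2 ^ l * z) * hsC

/-- Level `0` is excluded because its symbol is the same for every order. -/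
theorem maskSymbol_succ (μ : ℝ) {n m : ℕ} (hn : 1 ≤ n) (hm : m ≠ 0) (z : ℂ) :
    maskSymbol μ (n + 1) m z = (1 + z) / 2 * maskSymbol μ n m z := by
  obtain ⟨l, rfl⟩ := Nat.exists_eq_add_of_le' hn
  rw [maskSymbol_eq μ _ hm, maskSymbol_eq μ _ hm]
  ring

theorem norm_one_add_div_two_le {z : ℂ} (hz : ‖z‖ = 1) : ‖(1 + z) / 2‖ ≤ 1 := by
  have := norm_add_le 1 z
  rw [norm_div, Complex.norm_ofNat]
  rw [hz, norm_one] at this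
  linarith

theorem norm_pow_mul_sub_one_le {u v : ℂ} (hu : ‖u‖ ≤ 1) (l : ℕ) :
    ‖u ^ l * v - 1‖ ≤ l * ‖u - 1‖ + ‖v - 1‖ := by
  induction l with
  | zero => simp
  | succ l ih =>
    have h : u ^ (l + 1) * v - 1 = u * (u ^ l * v - 1) + (u - 1) := by ring
    have h1 : ‖u * (u ^ l * v - 1)‖ ≤ ‖u ^ l * v - 1‖ := by
      rw [norm_mul]
      exact mul_le_of_le_one_left (norm_nonneg _) hu
    rw [h]
    push_cast
    linarith [norm_add_le (u * (u ^ l * v - 1)) (u - 1)]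

theorem norm_maskSymbol_sub_one_le (μ : ℝ) {n : ℕ} (hn : 1 ≤ n) (m : ℕ) {z : ℂ} (hz : ‖z‖ = 1) :
    ‖maskSymbol μ n m z - 1‖ ≤ n * ‖z - 1‖ := by
  have hhalf : ‖(1 + z) / 2 - 1‖ ≤ ‖z - 1‖ := by
    rw [show (1 + z) / 2 - 1 = (z - 1) / 2 by ring, norm_div, Complex.norm_ofNat]
    linarith [norm_nonneg (z - 1)]
  obtain ⟨l, rfl⟩ := Nat.exists_eq_add_of_le' hn
  have hl : (0 : ℝ) ≤ l * ‖z - 1‖ := by positivity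
  rcases eq_or_ne m 0 with rfl | hm
  · rw [maskSymbol_zero]
    push_cast
    linarith
  · rw [maskSymbol_eq μ l hm]
    refine (norm_pow_mul_sub_one_le (norm_one_add_div_two_le hz) l).trans ?_
    have h1 := mul_le_mul_of_nonneg_left hhalf (Nat.cast_nonneg (α := ℝ) l)
    have h2 : ‖(tension μ m : ℂ) * ((1 + z) / 2) ^ 2 + (1 - tension μ m) * z - 1‖ ≤ ‖z - 1‖ := by
      have hs0 := (tension_pos μ m).le
      have hs1 := tension_le_one μ m
      -- This is the cofactor of `z - 1` in the quadratic factor minus `1`; it is a convex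
      -- combination of `(z + 3) / 4` and `1`, both in the unit disc.
      have h3 : ‖(tension μ m : ℂ) * ((z + 3) / 4) + ((1 - tension μ m : ℝ) : ℂ)‖ ≤ 1 := by
        refine (norm_add_le _ _).trans ?_
        rw [norm_mul, Complex.norm_of_nonneg hs0, Complex.norm_of_nonneg (by linarith), norm_div,
          Complex.norm_ofNat]
        have h4 : ‖z + 3‖ ≤ 4 := by
          have := norm_add_le z 3
          rw [hz, Complex.norm_ofNat] at this
          linarith
        nlinarith
      rw [show (tension μ m : ℂ) * ((1 + z) / 2) ^ 2 + (1 - tension μ m) * z - 1 =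
        (z - 1) * ((tension μ m : ℂ) * ((z + 3) / 4) + ((1 - tension μ m : ℝ) : ℂ)) by
          push_cast; ring, norm_mul]
      exact mul_le_of_le_one_right (norm_nonneg _) h3
    push_cast
    linarith

/-! ### Convergence of the infinite product -/

theorem exp_arg_eq (k : ℕ) (ω : ℝ) :
    Complex.exp (-Complex.I * (ω : ℂ) / 2 ^ (k + 1)) =
      Complex.exp (Complex.I * ((-(ω / 2 ^ (k + 1)) : ℝ) : ℂ)) := by
  congr 1
  push_cast
  ring

theorem norm_exp_arg (k : ℕ) (ω : ℝ) : ‖Complex.exp (-Complex.I * (ω : ℂ) / 2 ^ (k + 1))‖ = 1 := by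
  rw [exp_arg_eq, mul_comm, Complex.norm_exp_ofReal_mul_I]

theorem norm_phiFactor_sub_one_le (μ : ℝ) {n : ℕ} (hn : 1 ≤ n) (k : ℕ) (ω : ℝ) :
    ‖phiFactor μ n k ω - 1‖ ≤ n * (|ω| / 2 ^ (k + 1)) := by
  refine (norm_maskSymbol_sub_one_le μ hn k (norm_exp_arg k ω)).trans ?_
  gcongr
  rw [exp_arg_eq]
  refine Real.norm_exp_I_mul_ofReal_sub_one_le.trans ?_
  rw [norm_neg, Real.norm_eq_abs, abs_div, abs_of_pos (by positivity : (0 : ℝ) < 2 ^ (k + 1))]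

theorem multipliable_phiFactor (μ : ℝ) {n : ℕ} (hn : 1 ≤ n) (m : ℕ) (ω : ℝ) :
    Multipliable fun j : ℕ => phiFactor μ n (m + j) ω := by
  have hsum : Summable fun j : ℕ => phiFactor μ n (m + j) ω - 1 := by
    refine Summable.of_norm_bounded (g := fun j : ℕ => (n * |ω|) * (1 / 2 : ℝ) ^ j)
      (summable_geometric_two.mul_left _) fun j => ?_
    refine (norm_phiFactor_sub_one_le μ hn (m + j) ω).trans ?_
    rw [mul_div_assoc', one_div, inv_pow, ← div_eq_mul_inv]
    gcongr
    · norm_num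
    · omega
  simpa using multipliable_one_add_of_summable hsum.norm

theorem tendsto_prod_phiFactor (μ : ℝ) {n : ℕ} (hn : 1 ≤ n) (m : ℕ) (ω : ℝ) :
    Filter.Tendsto (fun N => ∏ j ∈ Finset.range N, phiFactor μ n (m + j) ω) Filter.atTop
      (nhds (phiHat μ n m ω)) :=
  (multipliable_phiFactor μ hn m ω).hasProd.tendsto_prod_nat

theorem continuous_phiFactor (μ : ℝ) (n k : ℕ) : Continuous (phiFactor μ n k) := by
  unfold phiFactor maskSymbol
  fun_prop

theorem aestronglyMeasurable_phiHat (μ : ℝ) {n : ℕ} (hn : 1 ≤ n) (m : ℕ) :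
    MeasureTheory.AEStronglyMeasurable (phiHat μ n m) := by
  refine aestronglyMeasurable_of_tendsto_ae Filter.atTop
    (f := fun N ω => ∏ j ∈ Finset.range N, phiFactor μ n (m + j) ω) (fun N => ?_)
    (Filter.Eventually.of_forall fun ω => tendsto_prod_phiFactor μ hn m ω)
  exact (continuous_finsetProd _ fun j _ => continuous_phiFactor μ n (m + j)).aestronglyMeasurable

theorem phiHat_eq_mul (μ : ℝ) {n : ℕ} (hn : 1 ≤ n) (m : ℕ) (ω : ℝ) :
    phiHat μ n m ω = phiFactor μ n m ω * phiHat μ n (m + 1) ω := by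
  refine tendsto_nhds_unique
    ((Filter.tendsto_add_atTop_iff_nat 1).2 (tendsto_prod_phiFactor μ hn m ω))
    (((tendsto_prod_phiFactor μ hn (m + 1) ω).const_mul _).congr fun N => ?_)
  rw [Finset.prod_range_succ', mul_comm, add_zero]
  refine congrArg (· * _) (Finset.prod_congr rfl fun j _ => ?_)
  rw [add_assoc, add_comm 1 j]

/-! ### Integrability of the Fourier transform -/

/-- The modulus of the symbol of order `1`, at the point `e^{-iω/2^{k+1}}`. -/
noncomputable def modFactor (μ : ℝ) (k : ℕ) (ω : ℝ) : ℝ :=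
  1 - tension μ k / 2 + tension μ k / 2 * Real.cos (ω / 2 ^ (k + 1))

theorem modFactor_nonneg (μ : ℝ) (k : ℕ) (ω : ℝ) : 0 ≤ modFactor μ k ω := by
  unfold modFactor
  nlinarith [tension_pos μ k, tension_le_one μ k, Real.neg_one_le_cos (ω / 2 ^ (k + 1))]

theorem modFactor_le_one (μ : ℝ) (k : ℕ) (ω : ℝ) : modFactor μ k ω ≤ 1 := by
  unfold modFactor
  nlinarith [tension_pos μ k, tension_le_one μ k, Real.cos_le_one (ω / 2 ^ (k + 1))]

/-- On the unit circle the quadratic factor is `z` times the nonnegative number `modFactor`, and the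
B-spline factor has modulus at most `1`. -/
theorem norm_phiFactor_le (μ : ℝ) {n k : ℕ} (hn : 1 ≤ n) (hk : k ≠ 0) (ω : ℝ) :
    ‖phiFactor μ n k ω‖ ≤ modFactor μ k ω := by
  obtain ⟨l, rfl⟩ := Nat.exists_eq_add_of_le' hn
  have hz := norm_exp_arg k ω
  unfold phiFactor
  rw [maskSymbol_eq μ l hk, norm_mul, norm_pow]
  refine (mul_le_of_le_one_left (norm_nonneg _)
    (pow_le_one₀ (norm_nonneg _) (norm_one_add_div_two_le hz))).trans (le_of_eq ?_)
  have hcos : 2 * ((Real.cos (ω / 2 ^ (k + 1)) : ℝ) : ℂ) =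
      (Complex.exp (-Complex.I * (ω : ℂ) / 2 ^ (k + 1)))⁻¹ +
        Complex.exp (-Complex.I * (ω : ℂ) / 2 ^ (k + 1)) := by
    rw [Complex.ofReal_cos, Complex.two_cos, ← Complex.exp_neg]
    congr 2 <;> push_cast <;> ring
  have hne := Complex.exp_ne_zero (-Complex.I * (ω : ℂ) / 2 ^ (k + 1))
  set z := Complex.exp (-Complex.I * (ω : ℂ) / 2 ^ (k + 1))
  have hfac : (tension μ k : ℂ) * ((1 + z) / 2) ^ 2 + (1 - tension μ k) * z =
      z * ((modFactor μ k ω : ℝ) : ℂ) := by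
    have h2 : z * (2 * ((Real.cos (ω / 2 ^ (k + 1)) : ℝ) : ℂ)) = 1 + z ^ 2 := by
      rw [hcos]
      field_simp
    unfold modFactor
    rw [Complex.ofReal_add, Complex.ofReal_mul]
    push_cast at h2 ⊢
    linear_combination (-(tension μ k : ℂ) / 4) * h2
  rw [hfac, norm_mul, hz, one_mul, Complex.norm_of_nonneg (modFactor_nonneg μ k ω)]

theorem continuous_modFactor (μ : ℝ) (k : ℕ) : Continuous (modFactor μ k) := by
  unfold modFactor
  fun_prop

/-- The partial products of the moduli. -/
noncomputable def modProd (μ : ℝ) (m N : ℕ) (ω : ℝ) : ℝ :=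
  ∏ j ∈ Finset.range N, modFactor μ (m + j) ω

theorem continuous_modProd (μ : ℝ) (m N : ℕ) : Continuous (modProd μ m N) :=
  continuous_finsetProd _ fun j _ => continuous_modFactor μ (m + j)

theorem modProd_periodic (μ : ℝ) (m N : ℕ) :
    Function.Periodic (modProd μ m N) (2 * Real.pi * 2 ^ (m + N)) := by
  intro ω
  unfold modProd
  refine Finset.prod_congr rfl fun j hj => ?_
  obtain ⟨d, rfl⟩ := Nat.exists_eq_add_of_lt (Finset.mem_range.1 hj)
  unfold modFactor
  have h : (ω + 2 * Real.pi * 2 ^ (m + (j + d + 1))) / 2 ^ (m + j + 1) =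
      ω / 2 ^ (m + j + 1) + ((2 ^ d : ℕ) : ℝ) * (2 * Real.pi) := by
    push_cast
    rw [show m + (j + d + 1) = m + j + 1 + d by ring, pow_add _ _ d]
    field_simp
  rw [h, Real.cos_add_nat_mul_two_pi]

theorem integral_modProd (μ : ℝ) (m N : ℕ) :
    ∫ ω in (0 : ℝ)..(2 * Real.pi * 2 ^ (m + N)), modProd μ m N ω =
      2 * Real.pi * 2 ^ m * ∏ j ∈ Finset.range N, (2 - tension μ (m + j)) := by
  induction N with
  | zero => simp [modProd]
  | succ N ih =>
    set L : ℝ := 2 * Real.pi * 2 ^ (m + N) with hL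
    have hL2 : 2 * Real.pi * 2 ^ (m + (N + 1)) = L + L := by rw [hL, ← add_assoc, pow_succ]; ring
    set s := tension μ (m + N)
    have hper := modProd_periodic μ m N
    rw [← hL] at hper
    have hcont := continuous_modProd μ m (N + 1)
    have hsplit := intervalIntegral.integral_add_adjacent_intervals
      (hcont.intervalIntegrable (μ := MeasureTheory.volume) 0 L)
      (hcont.intervalIntegrable (μ := MeasureTheory.volume) L (L + L))
    have hshift : ∫ ω in L..(L + L), modProd μ m (N + 1) ω =
        ∫ ω in (0 : ℝ)..L, modProd μ m (N + 1) (ω + L) := by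
      rw [intervalIntegral.integral_comp_add_right, zero_add]
    -- A shift by `L`, half the new period, fixes the old factors and flips the sign of the cosine
    -- in the new one.
    have hpt : ∀ ω, modProd μ m (N + 1) ω + modProd μ m (N + 1) (ω + L) =
        (2 - s) * modProd μ m N ω := by
      intro ω
      have h1 : ∀ x, modProd μ m (N + 1) x = modProd μ m N x * modFactor μ (m + N) x :=
        fun x => Finset.prod_range_succ _ _
      rw [h1, h1, hper ω]
      have h2 : (ω + L) / 2 ^ (m + N + 1) = ω / 2 ^ (m + N + 1) + Real.pi := by
        rw [hL, pow_succ]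
        field_simp
      unfold modFactor
      rw [h2, Real.cos_add_pi]
      ring
    have hcont' : Continuous fun ω => modProd μ m (N + 1) (ω + L) := by fun_prop
    rw [hL2, ← hsplit, hshift, ← intervalIntegral.integral_add
      (hcont.intervalIntegrable _ _) (hcont'.intervalIntegrable _ _)]
    simp only [hpt]
    rw [intervalIntegral.integral_const_mul, ih, Finset.prod_range_succ]
    ring

theorem prod_two_sub_tension_le {μ : ℝ} (hμ : 1 < μ) (m N : ℕ) :
    ∏ j ∈ Finset.range N, (2 - tension μ (m + j)) ≤ Real.exp (∑' k : ℕ, (k : ℝ) ^ (-μ)) := by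
  have hsum : Summable fun k : ℕ => (k : ℝ) ^ (-μ) := Real.summable_nat_rpow.2 (by linarith)
  calc ∏ j ∈ Finset.range N, (2 - tension μ (m + j))
      ≤ ∏ j ∈ Finset.range N, Real.exp (((m + j : ℕ) : ℝ) ^ (-μ)) := by
        refine Finset.prod_le_prod (fun j _ => ?_) fun j _ => ?_
        · linarith [tension_le_one μ (m + j)]
        · linarith [one_sub_tension_le μ (m + j), Real.add_one_le_exp (((m + j : ℕ) : ℝ) ^ (-μ))]
    _ = Real.exp (∑ j ∈ Finset.range N, ((m + j : ℕ) : ℝ) ^ (-μ)) := (Real.exp_sum _ _).symm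
    _ ≤ _ := by
        rw [Real.exp_le_exp, ← Finset.sum_image (f := fun k : ℕ => (k : ℝ) ^ (-μ))
          (g := fun j => m + j) (fun a _ b _ h => by simpa using h)]
        exact hsum.sum_le_tsum _ fun k _ => by positivity

/-- The factors beyond the first `N` have modulus at most `1` and can be dropped. -/
theorem norm_phiHat_le_modProd (μ : ℝ) {n m : ℕ} (hn : 1 ≤ n) (hm : m ≠ 0) (N : ℕ) (ω : ℝ) :
    ‖phiHat μ n m ω‖ ≤ modProd μ m N ω := by
  refine le_of_tendsto (tendsto_prod_phiFactor μ hn m ω).norm ?_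
  filter_upwards [Filter.eventually_ge_atTop N] with M hM
  rw [norm_prod]
  refine (Finset.prod_le_prod (fun _ _ => norm_nonneg _)
    fun j _ => norm_phiFactor_le μ hn (by omega) ω).trans ?_
  exact Finset.prod_le_prod_of_subset_of_le_one (Finset.range_subset_range.2 hM)
    (fun j _ => modFactor_nonneg μ (m + j) ω) fun j _ _ => modFactor_le_one μ (m + j) ω

theorem norm_phiHat_le_one (μ : ℝ) {n m : ℕ} (hn : 1 ≤ n) (hm : m ≠ 0) (ω : ℝ) :
    ‖phiHat μ n m ω‖ ≤ 1 := by
  simpa [modProd] using norm_phiHat_le_modProd μ hn hm 0 ω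

theorem integrable_phiHat_of_ne_zero {μ : ℝ} (hμ : 1 < μ) {n m : ℕ} (hn : 1 ≤ n) (hm : m ≠ 0) :
    MeasureTheory.Integrable (phiHat μ n m) := by
  have hmeas := aestronglyMeasurable_phiHat μ hn m
  have hL : Filter.Tendsto (fun N : ℕ => 2 * Real.pi * (2 : ℝ) ^ (m + N)) Filter.atTop
      Filter.atTop := by
    refine Filter.Tendsto.const_mul_atTop (by positivity) ?_
    refine (tendsto_pow_atTop_atTop_of_one_lt one_lt_two).comp ?_
    exact Filter.tendsto_atTop_mono (fun N => Nat.le_add_left N m) Filter.tendsto_id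
  have hloc : MeasureTheory.LocallyIntegrable (phiHat μ n m) := by
    refine MeasureTheory.LocallyIntegrable.mono
      (MeasureTheory.locallyIntegrable_const (1 : ℝ)) hmeas ?_
    exact Filter.Eventually.of_forall fun ω => by simpa using norm_phiHat_le_one μ hn hm ω
  -- The `N`-th interval covers exactly two periods of `modProd μ m N`, hence the leading `2` in a
  -- bound independent of `N`.
  refine MeasureTheory.integrable_of_intervalIntegral_norm_bounded
    (2 * (2 * Real.pi * 2 ^ m * Real.exp (∑' k : ℕ, (k : ℝ) ^ (-μ))))
    (a := fun N : ℕ => -(2 * Real.pi * (2 : ℝ) ^ (m + N)))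
    (b := fun N : ℕ => 2 * Real.pi * (2 : ℝ) ^ (m + N)) (l := Filter.atTop)
    (fun N => (hloc.integrableOn_isCompact isCompact_Icc).mono_set Set.Ioc_subset_Icc_self)
    (Filter.tendsto_neg_atTop_atBot.comp hL) hL (Filter.Eventually.of_forall fun N => ?_)
  set L : ℝ := 2 * Real.pi * 2 ^ (m + N) with hLdef
  have hL0 : 0 ≤ L := by positivity
  have hcont := continuous_modProd μ m N
  have hper := modProd_periodic μ m N
  rw [← hLdef] at hper
  calc ∫ ω in -L..L, ‖phiHat μ n m ω‖
      ≤ ∫ ω in -L..L, modProd μ m N ω :=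
        intervalIntegral.integral_mono_on (by linarith) 
          ((hloc.integrableOn_isCompact isCompact_uIcc).intervalIntegrable).norm
          (hcont.intervalIntegrable _ _) fun ω _ => norm_phiHat_le_modProd μ hn hm N ω
    _ = 2 * ∫ ω in (0 : ℝ)..L, modProd μ m N ω := by
        rw [← intervalIntegral.integral_add_adjacent_intervals
          (hcont.intervalIntegrable (μ := MeasureTheory.volume) (-L) 0)
          (hcont.intervalIntegrable (μ := MeasureTheory.volume) 0 L)]
        have h := hper.intervalIntegral_add_eq (-L) 0
        rw [neg_add_cancel, zero_add] at h
        rw [h]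
        ring
    _ ≤ _ := by
        rw [integral_modProd]
        gcongr
        exact prod_two_sub_tension_le hμ m N

theorem norm_phiFactor_zero_le (μ : ℝ) (n : ℕ) (ω : ℝ) : ‖phiFactor μ n 0 ω‖ ≤ 1 := by
  unfold phiFactor
  rw [maskSymbol_zero]
  exact norm_one_add_div_two_le (norm_exp_arg 0 ω)

theorem integrable_phiHat {μ : ℝ} (hμ : 1 < μ) {n : ℕ} (hn : 1 ≤ n) (m : ℕ) :
    MeasureTheory.Integrable (phiHat μ n m) := by
  rcases eq_or_ne m 0 with rfl | hm
  · refine (integrable_phiHat_of_ne_zero hμ hn one_ne_zero).mono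
      (aestronglyMeasurable_phiHat μ hn 0) (Filter.Eventually.of_forall fun ω => ?_)
    rw [phiHat_eq_mul μ hn, norm_mul]
    exact mul_le_of_le_one_left (norm_nonneg _) (norm_phiFactor_zero_le μ n ω)
  · exact integrable_phiHat_of_ne_zero hμ hn hm

theorem integrable_phiHat_mul_exp {μ : ℝ} (hμ : 1 < μ) {n : ℕ} (hn : 1 ≤ n) (m : ℕ) (x : ℝ) :
    MeasureTheory.Integrable fun ω : ℝ =>
      phiHat μ n m ω * Complex.exp (Complex.I * (ω : ℂ) * (x : ℂ)) := by
  refine (integrable_phiHat hμ hn m).mul_bdd (c := 1)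
    (by fun_prop) (Filter.Eventually.of_forall fun ω => ?_)
  rw [mul_assoc, ← Complex.ofReal_mul, mul_comm, Complex.norm_exp_ofReal_mul_I]

/-! ### Refinable equations -/

theorem phi_refinable {μ : ℝ} (hμ : 1 < μ) {n : ℕ} (hn : 1 ≤ n) (m : ℕ) (x : ℝ) :
    phi μ n m x =
      ∑ α ∈ Finset.range (n + 2), mask μ n m α * phi μ n (m + 1) (x - (α : ℝ) / 2 ^ (m + 1)) := by
  rw [← Complex.ofReal_inj]
  push_cast
  simp only [ofReal_phi]
  unfold phiInv
  simp only [mul_left_comm _ (1 / (2 * (Real.pi : ℂ)))]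
  rw [← Finset.mul_sum]
  congr 1
  simp only [← MeasureTheory.integral_const_mul]
  rw [← MeasureTheory.integral_finsetSum _ fun α _ =>
    (integrable_phiHat_mul_exp hμ hn (m + 1) _).const_mul _]
  refine MeasureTheory.integral_congr_ae (Filter.Eventually.of_forall fun ω => ?_)
  simp only
  rw [phiHat_eq_mul μ hn, phiFactor, maskSymbol, Finset.sum_mul, Finset.sum_mul]
  refine Finset.sum_congr rfl fun α _ => ?_
  have h : Complex.exp (Complex.I * (ω : ℂ) * ((x - (α : ℝ) / 2 ^ (m + 1) : ℝ) : ℂ)) =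
      Complex.exp (-Complex.I * (ω : ℂ) / 2 ^ (m + 1)) ^ α *
        Complex.exp (Complex.I * (ω : ℂ) * (x : ℂ)) := by
    rw [← Complex.exp_nat_mul, ← Complex.exp_add]
    congr 1
    push_cast
    ring
  rw [h]
  ring

/-! ### Raising the order on the Fourier side -/

/-- Finite telescoping, kept free of division because `1 - exp` may vanish. -/
theorem prod_phiFactor_succ_mul (μ : ℝ) {n m : ℕ} (hn : 1 ≤ n) (hm : m ≠ 0) (ω : ℝ) (N : ℕ) :
    (∏ j ∈ Finset.range N, phiFactor μ (n + 1) (m + j) ω) *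
        (2 ^ N * (1 - Complex.exp (-Complex.I * (ω : ℂ) / 2 ^ (m + N)))) =
      (1 - Complex.exp (-Complex.I * (ω : ℂ) / 2 ^ m)) *
        ∏ j ∈ Finset.range N, phiFactor μ n (m + j) ω := by
  induction N with
  | zero => simp
  | succ N ih =>
    have hsq : Complex.exp (-Complex.I * (ω : ℂ) / 2 ^ (m + N)) =
        Complex.exp (-Complex.I * (ω : ℂ) / 2 ^ (m + N + 1)) ^ 2 := by
      rw [← Complex.exp_nat_mul]
      congr 1
      rw [pow_succ _ (m + N)]
      push_cast
      field_simp
    rw [hsq] at ih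
    rw [Finset.prod_range_succ, Finset.prod_range_succ, ← mul_assoc (1 - _), ← ih]
    have h : phiFactor μ (n + 1) (m + N) ω =
        (1 + Complex.exp (-Complex.I * (ω : ℂ) / 2 ^ (m + N + 1))) / 2 *
          phiFactor μ n (m + N) ω := maskSymbol_succ μ hn (by omega) _
    rw [h, ← add_assoc m N 1]
    ring

/-- Minus the difference quotient of `t ↦ exp (-a t)` at `0`, along `t = 2^{-N}`. -/
theorem tendsto_two_pow_mul_one_sub_exp (a : ℂ) :
    Filter.Tendsto (fun N : ℕ => (2 : ℂ) ^ N * (1 - Complex.exp (-a / 2 ^ N))) Filter.atTop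
      (nhds a) := by
  have hd : HasDerivAt (fun t : ℂ => Complex.exp (-a * t)) (-a) 0 := by
    simpa using ((hasDerivAt_id (0 : ℂ)).const_mul (-a)).cexp
  have ht : Filter.Tendsto (fun N : ℕ => ((2 : ℂ) ^ N)⁻¹) Filter.atTop (nhdsWithin 0 {0}ᶜ) := by
    refine tendsto_nhdsWithin_iff.2 ⟨?_, Filter.Eventually.of_forall fun N => by simp⟩
    simpa using tendsto_pow_atTop_nhds_zero_of_norm_lt_one (x := (2 : ℂ)⁻¹) (by norm_num)
  have h := (hd.tendsto_slope_zero.comp ht).neg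
  rw [neg_neg] at h
  refine h.congr fun N => ?_
  simp [div_eq_mul_inv]
  ring

theorem phiHat_succ_mul_of_ne_zero (μ : ℝ) {n m : ℕ} (hn : 1 ≤ n) (hm : m ≠ 0) (ω : ℝ) :
    phiHat μ (n + 1) m ω * (Complex.I * ω / 2 ^ m) =
      (1 - Complex.exp (-Complex.I * (ω : ℂ) / 2 ^ m)) * phiHat μ n m ω := by
  refine tendsto_nhds_unique ?_ ((tendsto_prod_phiFactor μ hn m ω).const_mul _)
  simp only [← prod_phiFactor_succ_mul μ hn hm]
  refine (tendsto_prod_phiFactor μ (by omega) m ω).mul ?_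
  convert tendsto_two_pow_mul_one_sub_exp (Complex.I * ω / 2 ^ m) using 5
  rw [pow_add]
  field_simp

/-- The step of the difference in the differentiation rule. -/
noncomputable def step (m : ℕ) : ℝ := if m = 0 then 1 / 2 else 1 / 2 ^ m

theorem phiHat_succ_mul (μ : ℝ) {n : ℕ} (hn : 1 ≤ n) (m : ℕ) (ω : ℝ) :
    phiHat μ (n + 1) m ω * (Complex.I * ω) =
      (1 / step m : ℝ) * ((1 - Complex.exp (-Complex.I * (ω : ℂ) * step m)) * phiHat μ n m ω) := by
  rcases eq_or_ne m 0 with rfl | hm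
  -- The level-`0` factor is common to both orders, so the relation is inherited from level `1`;
  -- this is why the step is `1/2` rather than `1`.
  · have h := phiHat_succ_mul_of_ne_zero μ hn one_ne_zero ω
    have hf : phiFactor μ (n + 1) 0 ω = phiFactor μ n 0 ω := by
      simp only [phiFactor, maskSymbol_zero]
    rw [phiHat_eq_mul μ (n := n + 1) (by omega), phiHat_eq_mul μ hn, hf]
    simp only [step, if_true]
    push_cast
    rw [pow_one] at h
    rw [mul_one_div]
    linear_combination 2 * phiFactor μ n 0 ω * h
  · have h := phiHat_succ_mul_of_ne_zero μ hn hm ω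
    simp only [step, if_neg hm]
    push_cast
    rw [mul_one_div, ← h]
    field_simp

/-! ### Differentiation under the integral -/

theorem hasDerivAt_phiInv {μ : ℝ} (hμ : 1 < μ) {n : ℕ} (hn : 1 ≤ n) (m : ℕ) (x : ℝ) :
    HasDerivAt (phiInv μ (n + 1) m)
      ((1 / step m : ℝ) * (phiInv μ n m x - phiInv μ n m (x - step m))) x := by
  have hshift : ∀ y ω : ℝ, phiHat μ (n + 1) m ω *
      (Complex.exp (Complex.I * (ω : ℂ) * (y : ℂ)) * (Complex.I * ω)) =
      (1 / step m : ℝ) * (phiHat μ n m ω * Complex.exp (Complex.I * (ω : ℂ) * (y : ℂ)) -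
        phiHat μ n m ω * Complex.exp (Complex.I * (ω : ℂ) * ((y - step m : ℝ) : ℂ))) := by
    intro y ω
    have h := phiHat_succ_mul μ hn m ω
    have he : Complex.exp (Complex.I * (ω : ℂ) * ((y - step m : ℝ) : ℂ)) =
        Complex.exp (Complex.I * (ω : ℂ) * (y : ℂ)) *
          Complex.exp (-Complex.I * (ω : ℂ) * step m) := by
      rw [← Complex.exp_add]
      congr 1
      push_cast
      ring
    rw [he]
    linear_combination Complex.exp (Complex.I * (ω : ℂ) * (y : ℂ)) * h
  -- The growth of `ω` is absorbed by passing to order `n`, whose transform is integrable.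
  have hint : ∀ y : ℝ, MeasureTheory.Integrable fun ω : ℝ => phiHat μ (n + 1) m ω *
      (Complex.exp (Complex.I * (ω : ℂ) * (y : ℂ)) * (Complex.I * ω)) := by
    intro y
    simp only [hshift]
    exact ((integrable_phiHat_mul_exp hμ hn m y).sub
      (integrable_phiHat_mul_exp hμ hn m _)).const_mul _
  have hnorm : ∀ y ω : ℝ, ‖Complex.exp (Complex.I * (ω : ℂ) * (y : ℂ))‖ = 1 := by
    intro y ω
    rw [mul_assoc, ← Complex.ofReal_mul, mul_comm, Complex.norm_exp_ofReal_mul_I]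
  have key := hasDerivAt_integral_of_dominated_loc_of_deriv_le
    (F := fun (y ω : ℝ) => phiHat μ (n + 1) m ω * Complex.exp (Complex.I * (ω : ℂ) * (y : ℂ)))
    (F' := fun (y ω : ℝ) => phiHat μ (n + 1) m ω *
      (Complex.exp (Complex.I * (ω : ℂ) * (y : ℂ)) * (Complex.I * ω)))
    (x₀ := x) (s := Set.univ) (μ := MeasureTheory.volume)
    -- The norm of the differentiated integrand does not depend on `y`, so its value at `y = 0`
    -- dominates.
    (bound := fun ω => ‖phiHat μ (n + 1) m ω *
      (Complex.exp (Complex.I * (ω : ℂ) * ((0 : ℝ) : ℂ)) * (Complex.I * ω))‖)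
    Filter.univ_mem
    (Filter.Eventually.of_forall fun y =>
      (integrable_phiHat_mul_exp hμ (by omega) m y).aestronglyMeasurable)
    (integrable_phiHat_mul_exp hμ (by omega) m x)
    (hint x).aestronglyMeasurable
    (Filter.Eventually.of_forall fun ω y _ => by simp only [norm_mul, hnorm, le_refl])
    (hint 0).norm
    (Filter.Eventually.of_forall fun ω y _ => by
      have h := ((hasDerivAt_id y).ofReal_comp.const_mul (Complex.I * (ω : ℂ))).cexp
      simpa using h.const_mul (phiHat μ (n + 1) m ω))
  refine (key.2.const_mul (1 / (2 * (Real.pi : ℂ)))).congr_deriv ?_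
  simp only [hshift]
  unfold phiInv
  rw [MeasureTheory.integral_const_mul, MeasureTheory.integral_sub
    (integrable_phiHat_mul_exp hμ hn m _) (integrable_phiHat_mul_exp hμ hn m _)]
  ring

theorem hasDerivAt_phi {μ : ℝ} (hμ : 1 < μ) {n : ℕ} (hn : 1 ≤ n) (m : ℕ) (x : ℝ) :
    HasDerivAt (phi μ (n + 1) m) (nabla (step m) (phi μ n m) x) x := by
  have h := Complex.reCLM.hasFDerivAt.comp_hasDerivAt x (hasDerivAt_phiInv hμ hn m x)
  refine h.congr_deriv ?_
  simp only [Complex.reCLM_apply, Complex.re_ofReal_mul, Complex.sub_re]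
  rfl

theorem continuous_phi {μ : ℝ} (hμ : 1 < μ) {n : ℕ} (hn : 1 ≤ n) (m : ℕ) :
    Continuous (phi μ n m) := by
  refine Complex.continuous_re.comp (continuous_const.mul ?_)
  refine MeasureTheory.continuous_of_dominated (bound := fun ω => ‖phiHat μ n m ω‖)
    (fun x => (integrable_phiHat_mul_exp hμ hn m x).aestronglyMeasurable)
    (fun x => Filter.Eventually.of_forall fun ω => ?_) (integrable_phiHat hμ hn m).norm
    (Filter.Eventually.of_forall fun ω => by fun_prop)
  rw [norm_mul, mul_assoc, ← Complex.ofReal_mul, mul_comm Complex.I,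
    Complex.norm_exp_ofReal_mul_I, mul_one]

/-! ### Iteration of the first-order rule -/

/-- Each new derivative acts on the innermost function, so its difference enters inside the previous
ones. -/
theorem nablaIter_succ (h : ℝ) (r : ℕ) (f : ℝ → ℝ) :
    nablaIter h (r + 1) f = nablaIter h r (nabla h f) := by
  induction r with
  | zero => rfl
  | succ r ih =>
    rw [nablaIter, ih]
    rfl

theorem HasDerivAt.nabla {h : ℝ} {f f' : ℝ → ℝ} (hf : ∀ x, HasDerivAt f (f' x) x) (x : ℝ) :
    HasDerivAt (nabla h f) (_root_.nabla h f' x) x :=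
  ((hf x).sub ((hf (x - h)).comp_sub_const x h)).const_mul (1 / h)

theorem HasDerivAt.nablaIter {h : ℝ} {f f' : ℝ → ℝ} (hf : ∀ x, HasDerivAt f (f' x) x) (r : ℕ)
    (x : ℝ) : HasDerivAt (nablaIter h r f) (_root_.nablaIter h r f' x) x := by
  induction r generalizing x with
  | zero => exact hf x
  | succ r ih => exact HasDerivAt.nabla ih x

theorem ContDiff.nabla {k : WithTop ℕ∞} {h : ℝ} {f : ℝ → ℝ} (hf : ContDiff ℝ k f) :
    ContDiff ℝ k (nabla h f) :=
  contDiff_const.mul (hf.sub (hf.comp (contDiff_id.sub contDiff_const)))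

theorem contDiff_phi {μ : ℝ} (hμ : 1 < μ) (m r : ℕ) {n : ℕ} (hr : r < n) :
    ContDiff ℝ r (phi μ n m) := by
  induction r generalizing n with
  | zero => simpa using (contDiff_zero (𝕜 := ℝ)).2 (continuous_phi hμ hr m)
  | succ r ih =>
    obtain ⟨l, rfl⟩ : ∃ l, n = l + 1 := ⟨n - 1, by omega⟩
    have hd := hasDerivAt_phi hμ (n := l) (by omega) m
    push_cast
    rw [contDiff_succ_iff_deriv (𝕜 := ℝ)]
    refine ⟨fun x => (hd x).differentiableAt, by simp, ?_⟩
    rw [show deriv (phi μ (l + 1) m) = nabla (step m) (phi μ l m) from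
      funext fun x => (hd x).deriv]
    exact (ih (by omega)).nabla

theorem iteratedDeriv_phi {μ : ℝ} (hμ : 1 < μ) (m r : ℕ) {n : ℕ} (hr : r < n) :
    iteratedDeriv r (phi μ n m) = nablaIter (step m) r (phi μ (n - r) m) := by
  induction r with
  | zero => simp [nablaIter]
  | succ r ih =>
    obtain ⟨l, hl⟩ : ∃ l, n - r = l + 1 := ⟨n - r - 1, by omega⟩
    have hd := hasDerivAt_phi hμ (n := l) (by omega) m
    rw [iteratedDeriv_succ, ih (by omega), hl, show n - (r + 1) = l by omega, nablaIter_succ]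
    exact funext fun x => (HasDerivAt.nablaIter hd r x).deriv

theorem mainTheorem5 (μ : ℝ) (hμ : 1 < μ) :
    -- the functions `φ^{(k,m)}` are well defined and solve the refinable equations
    (∀ k m : ℕ, 1 ≤ k →
      (∀ ω : ℝ, Multipliable fun j : ℕ => phiFactor μ k (m + j) ω) ∧
      MeasureTheory.Integrable (phiHat μ k m) ∧
      ∀ x : ℝ, phi μ k m x =
        ∑ α ∈ Finset.range (k + 2), mask μ k m α * phi μ k (m + 1) (x - (α : ℝ) / 2 ^ (m + 1))) ∧
    -- the differentiation rule
    (∀ n r : ℕ, 2 ≤ n → r ≤ n - 1 →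
      (ContDiff ℝ (r : ℕ∞) (phi μ n 0) ∧
        iteratedDeriv r (phi μ n 0) = nablaIter (1 / 2) r (phi μ (n - r) 0)) ∧
      ∀ m : ℕ, 0 < m →
        (ContDiff ℝ (r : ℕ∞) (phi μ n m) ∧
          iteratedDeriv r (phi μ n m) = nablaIter (1 / 2 ^ m) r (phi μ (n - r) m))) := by
  refine ⟨fun k m hk => ⟨multipliable_phiFactor μ hk m, integrable_phiHat hμ hk m,
    phi_refinable hμ hk m⟩, fun n r hn hr => ?_⟩
  have hlt : r < n := by omega
  refine ⟨⟨contDiff_phi hμ 0 r hlt, ?_⟩, fun m hm => ⟨contDiff_phi hμ m r hlt, ?_⟩⟩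
  · simpa only [step, if_true] using iteratedDeriv_phi hμ 0 r hlt
  · simpa only [step, if_neg hm.ne'] using iteratedDeriv_phi hμ m r hlt
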